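/- Let $T$ be a finitely generated torsion-free abelian group. For a probability distribution $P$ with finite support, write $H(P)=-\sum_a P(a)\log P(a)$ for its Shannon entropy, and $H(X)$ for the entropy of the distribution of a random variable $X$. For finitely supported probability distributions $P_X,P_Y$ on $T$, let $\Pi(X,Y)$ be the set of all joint distributions $P_{XY}$ on $T\times T$ with marginals $P_X$ and $P_Y$; the maximum $\max_{\Pi(X,Y)}H(X+Y)$ of the entropy of $X+Y$ over $P_{XY}\in\Pi(X,Y)$ is attained. Then for all finitely supported probability distributions $P_X,P_Y,P_Z$ on $T$, $$H(X)+\max_{\Pi(Y,Z)}H(Y+Z)\;\le\;\max_{\Pi(X,Y)}H(X+Y)+\max_{\Pi(X,Z)}H(X+Z).$$ Moreover, the validity of this inequality for all finitely supported $P_X,P_Y,P_Z$ on $T$ is equivalent to the validity of the sumset inequality $|A|\,|B+C|\le|A+B|\,|A+C|$ for all finite subsets $A,B,C\subseteq T$, where $A+B=\{a+b: a\in A,\ b\in B\}$. -/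

import Mathlib

open scoped Pointwise

noncomputable section

/-- Shannon entropy (in nats) of a discrete distribution: `H(p) = ∑ₐ -p(a) log p(a)`. For a finitely
supported `p` only finitely many terms are nonzero. -/
def shannonEntropy {α : Type*} (p : PMF α) : ℝ :=
  ∑' a, Real.negMulLog (p a).toReal

/-- The set of all couplings of `P` and `Q`: joint distributions on `α × β` whose first marginal
is `P` and whose second marginal is `Q`. -/
def couplings {α β : Type*} (P : PMF α) (Q : PMF β) : Set (PMF (α × β)) :=
  {μ | μ.map Prod.fst = P ∧ μ.map Prod.snd = Q}

/-- The set of all values `H(X + Y)`, where `(X, Y)` runs over the couplings of `P` and `Q`. -/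
def couplingSumEntropies {T : Type*} [AddCommGroup T] (P Q : PMF T) : Set ℝ :=
  (fun μ : PMF (T × T) => shannonEntropy (μ.map fun z => z.1 + z.2)) '' couplings P Q

/-- The maximal value of `H(X + Y)` over all couplings `(X, Y)` of `P` and `Q`. -/
def maxSumEntropy {T : Type*} [AddCommGroup T] (P Q : PMF T) : ℝ :=
  sSup (couplingSumEntropies P Q)

end

/-! The entropic inequality is a limit of sumset inequalities in powers of `T` (the method of
types). Couple X with an optimal pair (Y, Z) and approximate the joint law by empirical laws of
sequences of length n. The rearrangements of the sequences of X-, Y- and Z-values form sets A, B, C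
in T^n, to which Ruzsa's triangle inequality applies. Up to factors polynomial in n, |A| is at least
exp(n H(X)) and |B+C| at least exp(n H(Y+Z)) (`entropy_le_log_card_permOrbit`). Conversely, a random
coordinate of a random element of A+B is a sum of coupled copies of X and Y, whose entropy bounds
(log |A+B|)/n (`log_card_permOrbit_add_le`); likewise for A+C. Compactness of the simplex and
continuity of entropy remove the error. The sumset inequality is itself Ruzsa's, so both sides of
the equivalence hold. -/

/-! ### Empirical laws and counting of sequences -/

section EmpiricalLaws

open scoped Classical
open Finset Real

/-- The law of `g j` for a uniformly random index `j`. -/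
noncomputable def empLaw {J α : Type*} [Fintype J] (g : J → α) (a : α) : ℝ :=
  (#{j | g j = a} : ℝ) / Fintype.card J

/-- The push-forward of a weight function along `f`. -/
noncomputable def pushLaw {α β : Type*} [Fintype α] (f : α → β) (p : α → ℝ) (b : β) : ℝ :=
  ∑ a with f a = b, p a

/-- The entropy of the push-forward of a weight function along `f`. -/
noncomputable def pushEntropy {α β : Type*} [Fintype α] (f : α → β) (p : α → ℝ) : ℝ :=
  ∑ b ∈ univ.image f, negMulLog (pushLaw f p b)

/-- The orbit of a sequence under permutations of its indices. -/
noncomputable def permOrbit {ι T : Type*} [Fintype ι] (f : ι → T) : Finset (ι → T) :=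
  univ.image fun σ : Equiv.Perm ι => f ∘ σ

theorem pushLaw_empLaw {J α β : Type*} [Fintype J] [Fintype α] (f : α → β) (g : J → α) :
    pushLaw f (empLaw g) = empLaw (f ∘ g) := by
  funext b
  simp only [pushLaw, empLaw, ← sum_div]
  congr 1
  rw [← Nat.cast_sum, Nat.cast_inj,
    card_eq_sum_card_fiberwise (f := g) (t := univ.filter fun a => f a = b)]
  · refine sum_congr rfl fun a ha => ?_
    congr 1
    ext j
    simp only [mem_filter, mem_univ, true_and, Function.comp] at ha ⊢
    constructor
    · rintro rfl; exact ⟨ha, rfl⟩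
    · exact fun h => h.2
  · intro j hj
    simpa using hj

theorem empLaw_nonneg {J α : Type*} [Fintype J] (g : J → α) (a : α) : 0 ≤ empLaw g a := by
  unfold empLaw; positivity

theorem sum_empLaw {J α : Type*} [Fintype J] [Nonempty J] (g : J → α) (s : Finset α)
    (hs : ∀ j, g j ∈ s) : ∑ a ∈ s, empLaw g a = 1 := by
  simp only [empLaw, ← sum_div]
  rw [← Nat.cast_sum, ← card_eq_sum_card_fiberwise (f := g) (s := univ) (t := s)
    (fun j _ => hs j), card_univ, div_self]
  exact_mod_cast Fintype.card_ne_zero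

theorem empLaw_mem_stdSimplex {J α : Type*} [Fintype J] [Nonempty J] [Fintype α] (g : J → α) :
    empLaw g ∈ stdSimplex ℝ α :=
  ⟨empLaw_nonneg g, sum_empLaw g univ fun _ => mem_univ _⟩

theorem empLaw_comp_perm {J α : Type*} [Fintype J] (g : J → α) (σ : Equiv.Perm J) :
    empLaw (g ∘ σ) = empLaw g := by
  funext a
  unfold empLaw
  congr 2
  exact card_bij (fun j _ => σ j) (by simp) (by simp)
    (fun j hj => ⟨σ.symm j, by simpa using hj, by simp⟩)

theorem empLaw_prod {K J α : Type*} [Fintype K] [Nonempty K] [Fintype J] (g : K × J → α)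
    (q : α → ℝ) (h : ∀ k, empLaw (fun j => g (k, j)) = q) : empLaw g = q := by
  funext a
  have hc : (#{z | g z = a} : ℝ) = ∑ k : K, (#{j | g (k, j) = a} : ℝ) := by
    simp only [card_filter, Nat.cast_sum]
    rw [Fintype.sum_prod_type]
  have hk : (Fintype.card K : ℝ) ≠ 0 := by exact_mod_cast Fintype.card_ne_zero
  simp only [empLaw, hc, Fintype.card_prod, Nat.cast_mul]
  rw [← div_div, div_right_comm, sum_div]
  have : ∀ k, (#{j | g (k, j) = a} : ℝ) / Fintype.card J = q a := fun k => congrFun (h k) a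
  simp only [this, sum_const, card_univ, nsmul_eq_mul]
  field_simp

/-- The cardinality of a set of sequences is bounded by the exponential of the entropy of a random
entry of a random sequence. -/
theorem log_card_le_entropy {ι T : Type*} [Fintype ι] [Nonempty ι] (E : Finset (ι → T))
    (hE : E.Nonempty) (S : Finset T) (hS : ∀ w ∈ E, ∀ i, w i ∈ S) :
    log #E ≤ Fintype.card ι *
      ∑ t ∈ S, negMulLog (empLaw (fun z : E × ι => z.1.1 z.2) t) := by
  have : Nonempty E := hE.to_subtype
  set Q : T → ℝ := empLaw (fun z : E × ι => z.1.1 z.2) with hQ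
  have hm : (0 : ℝ) < #E := by exact_mod_cast hE.card_pos
  have hn : (0 : ℝ) < Fintype.card ι := by exact_mod_cast Fintype.card_pos
  have hpos : ∀ w ∈ E, ∀ i, 0 < Q (w i) := by
    intro w hw i
    rw [hQ]; unfold empLaw
    refine div_pos ?_ (by exact_mod_cast Fintype.card_pos)
    exact_mod_cast card_pos.2 ⟨((⟨w, hw⟩ : E), i), by simp⟩
  -- The product law with all factors `Q` gives `E` mass at most 1.
  have hsum : ∑ w ∈ E, ∏ i, Q (w i) ≤ 1 := by
    have h1 : ∑ w ∈ Fintype.piFinset (fun _ : ι => S), ∏ i, Q (w i) = 1 := by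
      rw [← prod_univ_sum (fun _ : ι => S) (fun _ t => Q t)]
      have hQ1 : ∑ t ∈ S, Q t = 1 :=
        sum_empLaw (fun z : E × ι => z.1.1 z.2) S fun z => hS _ z.1.2 z.2
      simp [hQ1]
    rw [← h1]
    refine sum_le_sum_of_subset_of_nonneg ?_ fun w _ _ => prod_nonneg fun i _ => empLaw_nonneg _ _
    intro w hw
    simpa using hS w hw
  have hlog : ∑ w ∈ E, ∑ i, log (Q (w i)) =
      #E * Fintype.card ι * ∑ t ∈ S, Q t * log (Q t) := by
    have h2 : ∀ t, #E * Fintype.card ι * Q t = #{z : E × ι | z.1.1 z.2 = t} := by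
      intro t
      simp only [hQ, empLaw, Fintype.card_prod, Fintype.card_coe, Nat.cast_mul]
      field_simp
    rw [mul_sum]
    simp only [← mul_assoc, h2]
    rw [← sum_coe_sort E, ← Fintype.sum_prod_type' (f := fun (w : E) i => log (Q (w.1 i))),
      ← sum_fiberwise_of_maps_to (s := univ) (t := S) (g := fun z : E × ι => z.1.1 z.2)
        (fun z _ => hS _ z.1.2 z.2)]
    refine sum_congr rfl fun t _ => ?_
    rw [sum_congr rfl (g := fun _ => log (Q t)), sum_const, nsmul_eq_mul]
    intro z hz
    simp only [mem_filter, mem_univ, true_and] at hz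
    rw [hz]
  -- Gibbs' inequality for the uniform law on `E` against the product law, via `log x ≤ x - 1`.
  have hjen : ∑ w ∈ E, (log #E + ∑ i, log (Q (w i))) ≤ 0 := by
    calc ∑ w ∈ E, (log #E + ∑ i, log (Q (w i)))
        ≤ ∑ w ∈ E, (#E * ∏ i, Q (w i) - 1) := by
          refine sum_le_sum fun w hw => ?_
          have hp : 0 < ∏ i, Q (w i) := prod_pos fun i _ => hpos w hw i
          rw [← log_prod fun i _ => (hpos w hw i).ne', ← log_mul hm.ne' hp.ne']
          exact log_le_sub_one_of_pos (mul_pos hm hp)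
      _ = #E * ∑ w ∈ E, ∏ i, Q (w i) - #E := by simp [sum_sub_distrib, mul_sum]
      _ ≤ 0 := by nlinarith
  rw [sum_add_distrib, sum_const, nsmul_eq_mul, hlog, mul_assoc, ← mul_add] at hjen
  have := nonpos_of_mul_nonpos_right hjen hm
  simp only [negMulLog, neg_mul, sum_neg_distrib]
  linarith

theorem log_factorial_le (a : ℕ) : log a.factorial ≤ a * log a - a + 2 * log (a + 1) := by
  induction a with
  | zero => simp
  | succ a ih =>
    rw [Nat.factorial_succ, Nat.cast_mul, log_mul (by positivity) (by positivity)]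
    push_cast at ih ⊢
    have h1 : (1 : ℝ) / (a + 2) ≤ log (a + 1 + 1) - log (a + 1) := by
      rw [← log_div (by positivity) (by positivity)]
      refine le_trans (le_of_eq ?_) (one_sub_inv_le_log_of_pos (by positivity))
      field_simp; ring
    have h2 : (a : ℝ) / (a + 1) ≤ a * (log (a + 1) - log a) := by
      rcases Nat.eq_zero_or_pos a with rfl | ha
      · simp
      have ha' : (0 : ℝ) < a := by exact_mod_cast ha
      rw [← log_div (by positivity) (by positivity), div_eq_mul_inv]
      refine mul_le_mul_of_nonneg_left ?_ ha'.le
      refine le_trans (le_of_eq ?_) (one_sub_inv_le_log_of_pos (by positivity))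
      field_simp; ring
    -- The factor 2 on the error term is needed here; with 1 this fails.
    have h3 : (1 : ℝ) ≤ a / (a + 1) + 2 * (1 / (a + 2)) := by
      rw [← sub_nonneg]
      have : (a : ℝ) / (a + 1) + 2 * (1 / (a + 2)) - 1 = a / ((a + 1) * (a + 2)) := by
        field_simp; ring
      rw [this]; positivity
    nlinarith

/-- Orbit–stabilizer: the permutations fixing `f` permute each of its fibres independently. -/
theorem card_permOrbit_mul {ι T : Type*} [Fintype ι] (f : ι → T) :
    #(permOrbit f) * ∏ t ∈ univ.image f, (#{i | f i = t}).factorial =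
      (Fintype.card ι).factorial := by
  have h1 : ∏ t ∈ univ.image f, (#{i | f i = t}).factorial =
      #{g : Equiv.Perm ι | f ∘ g = f} := by
    have := DomMulAct.stabilizer_card' f
    simp only [Fintype.card_subtype] at this
    exact this.symm
  have h2 : (Fintype.card ι).factorial = #(univ : Finset (Equiv.Perm ι)) := by
    rw [card_univ, Fintype.card_perm]
  rw [h1, h2, card_eq_sum_card_image (fun σ : Equiv.Perm ι => f ∘ σ) univ, ← smul_eq_mul,
    ← sum_const]
  refine sum_congr rfl fun w hw => ?_
  obtain ⟨τ, -, rfl⟩ := mem_image.1 hw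
  refine card_bij (fun g _ => g * τ) ?_ ?_ ?_
  · intro g hg
    simp only [mem_filter, mem_univ, true_and] at hg ⊢
    rw [Equiv.Perm.coe_mul, ← Function.comp_assoc, hg]
  · intro g _ g' _ h
    exact mul_right_cancel h
  · intro g hg
    refine ⟨g * τ⁻¹, ?_, by simp⟩
    simp only [mem_filter, mem_univ, true_and] at hg ⊢
    rw [Equiv.Perm.coe_mul, ← Function.comp_assoc, hg, Function.comp_assoc,
      ← Equiv.Perm.coe_mul]
    simp

/-- The orbit size is a multinomial coefficient; Stirling-type bounds on its factorials cost only a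
logarithm per value of `f`. -/
theorem entropy_le_log_card_permOrbit {ι T : Type*} [Fintype ι] [Nonempty ι] (f : ι → T) :
    Fintype.card ι * ∑ t ∈ univ.image f, negMulLog (empLaw f t) ≤
      log #(permOrbit f) + 2 * #(univ.image f) * log (Fintype.card ι + 1) := by
  set n := Fintype.card ι with hn
  have hn0 : (0 : ℝ) < n := by exact_mod_cast Fintype.card_pos
  set a : T → ℕ := fun t => #{i | f i = t} with ha
  have ha0 : ∀ t ∈ univ.image f, (0 : ℝ) < a t := by
    intro t ht
    obtain ⟨i, -, rfl⟩ := mem_image.1 ht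
    exact_mod_cast card_pos.2 ⟨i, by simp⟩
  have hsum : ∑ t ∈ univ.image f, (a t : ℝ) = n := by
    rw [← Nat.cast_sum, hn, ← card_univ, card_eq_sum_card_image f univ]
  have hO : (#(permOrbit f) : ℝ) ≠ 0 := by
    refine Nat.cast_ne_zero.2 (card_pos.2 ⟨f, ?_⟩).ne'
    exact mem_image.2 ⟨1, mem_univ _, by simp⟩
  have hcard : log #(permOrbit f) + ∑ t ∈ univ.image f, log (a t).factorial =
      log n.factorial := by
    rw [← card_permOrbit_mul f, Nat.cast_mul, Nat.cast_prod, log_mul hO, log_prod]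
    · intro t _; positivity
    · exact prod_ne_zero_iff.2 fun t _ => by positivity
  have hup : ∑ t ∈ univ.image f, log (a t).factorial ≤
      ∑ t ∈ univ.image f, (a t * log (a t)) - n + 2 * #(univ.image f) * log (n + 1) := by
    calc ∑ t ∈ univ.image f, log (a t).factorial
        ≤ ∑ t ∈ univ.image f, (a t * log (a t) - a t + 2 * log (n + 1)) := by
          refine sum_le_sum fun t _ => (log_factorial_le _).trans ?_
          have : (a t : ℝ) ≤ n := by exact_mod_cast card_le_univ _
          gcongr
      _ = _ := by
          rw [sum_add_distrib, sum_sub_distrib, hsum, sum_const, nsmul_eq_mul]; ring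
  have hlow : (n : ℝ) * log n - n ≤ log n.factorial := by
    have h := Stirling.le_log_factorial_stirling (n := n) (by exact_mod_cast hn0.ne')
    have h1 : 0 ≤ log n := log_natCast_nonneg n
    have h2 : 0 ≤ log (2 * π) := log_nonneg (by linarith [pi_gt_three])
    linarith
  have hent : n * ∑ t ∈ univ.image f, negMulLog (empLaw f t) =
      n * log n - ∑ t ∈ univ.image f, (a t * log (a t)) := by
    have : ∀ t ∈ univ.image f, n * negMulLog (empLaw f t) = a t * log n - a t * log (a t) := by
      intro t ht
      have : empLaw f t = a t / n := rfl
      rw [this, negMulLog, log_div (ha0 t ht).ne' hn0.ne']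
      field_simp
      ring
    rw [mul_sum, sum_congr rfl this, sum_sub_distrib, ← sum_mul, hsum]
  linarith

end EmpiricalLaws

/-! ### From sumsets to entropy, and the limit of long sequences -/

section EmpiricalInequality

open scoped Classical
open Finset Real Filter Topology

theorem pushEntropy_empLaw {J α β : Type*} [Fintype J] [Fintype α] (f : α → β) (g : J → α) :
    pushEntropy f (empLaw g) = ∑ b ∈ univ.image (f ∘ g), negMulLog (empLaw (f ∘ g) b) := by
  unfold pushEntropy
  rw [pushLaw_empLaw]
  refine (sum_subset ?_ ?_).symm
  · intro b hb
    obtain ⟨j, -, rfl⟩ := mem_image.1 hb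
    exact mem_image.2 ⟨g j, mem_univ _, rfl⟩
  · intro b _ hb
    have : #{j | (f ∘ g) j = b} = 0 := by
      rw [card_eq_zero, filter_eq_empty_iff]
      exact fun j _ h => hb (mem_image.2 ⟨j, mem_univ _, h⟩)
    rw [empLaw, this]
    simp

/-- Write each element of the sumset with chosen permutations σ, τ. For a uniform element and
coordinate, the pair of permuted indices couples `empLaw p` with itself, since permuting preserves
the empirical law. Working on `Ω × Ω` keeps all couplings in one simplex. -/
theorem log_card_permOrbit_add_le {ι Ω T : Type*} [Fintype ι] [Nonempty ι] [Fintype Ω]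
    [AddCommGroup T] (p : ι → Ω) (X Y : Ω → T) :
    ∃ c ∈ stdSimplex ℝ (Ω × Ω), pushLaw Prod.fst c = empLaw p ∧ pushLaw Prod.snd c = empLaw p ∧
      log #(permOrbit (X ∘ p) + permOrbit (Y ∘ p)) ≤
        Fintype.card ι * pushEntropy (fun z : Ω × Ω => X z.1 + Y z.2) c := by
  set E := permOrbit (X ∘ p) + permOrbit (Y ∘ p) with hE
  have hmem : ∀ w : E, ∃ σ τ : Equiv.Perm ι, ∀ i, w.1 i = X (p (σ i)) + Y (p (τ i)) := by
    rintro ⟨w, hw⟩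
    obtain ⟨a, ha, b, hb, rfl⟩ := mem_add.1 hw
    obtain ⟨σ, -, rfl⟩ := mem_image.1 ha
    obtain ⟨τ, -, rfl⟩ := mem_image.1 hb
    exact ⟨σ, τ, fun i => rfl⟩
  choose σ τ hστ using hmem
  have horb : ∀ f : ι → T, (permOrbit f).Nonempty := fun f => univ_nonempty.image _
  have hne : E.Nonempty := (horb _).add (horb _)
  have : Nonempty E := hne.to_subtype
  set g : E × ι → Ω × Ω := fun z => (p (σ z.1 z.2), p (τ z.1 z.2)) with hg
  have hfg : (fun z : Ω × Ω => X z.1 + Y z.2) ∘ g = fun z : E × ι => z.1.1 z.2 := by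
    funext z
    exact (hστ z.1 z.2).symm
  refine ⟨empLaw g, empLaw_mem_stdSimplex g, ?_, ?_, ?_⟩
  · rw [pushLaw_empLaw]
    exact empLaw_prod _ _ fun w => empLaw_comp_perm p (σ w)
  · rw [pushLaw_empLaw]
    exact empLaw_prod _ _ fun w => empLaw_comp_perm p (τ w)
  · rw [pushEntropy_empLaw, hfg]
    exact log_card_le_entropy E hne _ fun w hw i =>
      mem_image.2 ⟨((⟨w, hw⟩ : E), i), mem_univ _, rfl⟩

theorem pushEntropy_empLaw_le {ι Ω T : Type*} [Fintype ι] [Nonempty ι] [Fintype Ω]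
    (p : ι → Ω) (X : Ω → T) :
    Fintype.card ι * pushEntropy X (empLaw p) ≤
      log #(permOrbit (X ∘ p)) + 2 * Fintype.card Ω * log (Fintype.card ι + 1) := by
  rw [pushEntropy_empLaw]
  refine (entropy_le_log_card_permOrbit _).trans ?_
  have h : #(univ.image (X ∘ p)) ≤ Fintype.card Ω := by
    rw [← image_image, ← card_univ]
    exact card_image_le.trans (card_le_univ _)
  have : 0 ≤ log (Fintype.card ι + 1 : ℝ) := log_nonneg (by simp)
  gcongr

/-- The entropic sum triangle inequality for empirical laws, up to a logarithmic error. -/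
theorem empLaw_entropy_triangle {ι Ω T : Type*} [Fintype ι] [Nonempty ι] [Fintype Ω]
    [AddCommGroup T] (p : ι → Ω) (X Y Z : Ω → T) :
    ∃ c ∈ stdSimplex ℝ (Ω × Ω), ∃ d ∈ stdSimplex ℝ (Ω × Ω),
      pushLaw Prod.fst c = empLaw p ∧ pushLaw Prod.snd c = empLaw p ∧
      pushLaw Prod.fst d = empLaw p ∧ pushLaw Prod.snd d = empLaw p ∧
      pushEntropy X (empLaw p) + pushEntropy (fun ω => Y ω + Z ω) (empLaw p) ≤
        pushEntropy (fun z : Ω × Ω => X z.1 + Y z.2) c +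
        pushEntropy (fun z : Ω × Ω => X z.1 + Z z.2) d +
        4 * Fintype.card Ω * (log (Fintype.card ι + 1) / Fintype.card ι) := by
  obtain ⟨c, hc, hc1, hc2, hc3⟩ := log_card_permOrbit_add_le p X Y
  obtain ⟨d, hd, hd1, hd2, hd3⟩ := log_card_permOrbit_add_le p X Z
  refine ⟨c, hc, d, hd, hc1, hc2, hd1, hd2, ?_⟩
  have hn : (0 : ℝ) < Fintype.card ι := by exact_mod_cast Fintype.card_pos
  have hX := pushEntropy_empLaw_le p X
  have hYZ := pushEntropy_empLaw_le p fun ω => Y ω + Z ω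
  set A := permOrbit (X ∘ p)
  set B := permOrbit (Y ∘ p)
  set C := permOrbit (Z ∘ p)
  have horb : ∀ f : ι → T, (permOrbit f).Nonempty := fun f => univ_nonempty.image _
  -- Applying the same permutation to both summands preserves the joint law of Y and Z.
  have hsub : permOrbit ((fun ω => Y ω + Z ω) ∘ p) ⊆ B + C := by
    intro w hw
    obtain ⟨σ, -, rfl⟩ := mem_image.1 hw
    exact mem_add.2 ⟨_, mem_image_of_mem _ (mem_univ σ), _, mem_image_of_mem _ (mem_univ σ), rfl⟩
  have hposO : (0 : ℝ) < #(permOrbit ((fun ω => Y ω + Z ω) ∘ p)) := by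
    exact_mod_cast (horb _).card_pos
  have hlogO : log #(permOrbit ((fun ω => Y ω + Z ω) ∘ p)) ≤ log #(B + C) :=
    log_le_log hposO (by exact_mod_cast card_le_card hsub)
  have hA : (0 : ℝ) < #A := by exact_mod_cast (horb _).card_pos
  have hBC : (0 : ℝ) < #(B + C) := by exact_mod_cast ((horb _).add (horb _)).card_pos
  have hAB : (0 : ℝ) < #(A + B) := by exact_mod_cast ((horb _).add (horb _)).card_pos
  have hAC : (0 : ℝ) < #(A + C) := by exact_mod_cast ((horb _).add (horb _)).card_pos
  have htri : log #A + log #(B + C) ≤ log #(A + B) + log #(A + C) := by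
    rw [← log_mul hA.ne' hBC.ne', ← log_mul hAB.ne' hAC.ne']
    refine log_le_log (by positivity) ?_
    have h := ruzsa_triangle_inequality_add_add_add B A C
    rw [add_comm B A] at h
    have h' : #A * #(B + C) ≤ #(A + B) * #(A + C) := by rwa [mul_comm #A]
    exact_mod_cast h'
  refine le_of_mul_le_mul_left ?_ hn
  -- The 4 is 2 + 2, from the orbits of X and of Y + Z.
  have herr : Fintype.card ι * (4 * Fintype.card Ω *
      (log (Fintype.card ι + 1) / Fintype.card ι)) =
      4 * Fintype.card Ω * log (Fintype.card ι + 1 : ℝ) := by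
    field_simp
  rw [mul_add, mul_add, mul_add, herr]
  linarith

theorem continuous_pushLaw {α β : Type*} [Fintype α] (f : α → β) :
    Continuous (pushLaw f : (α → ℝ) → β → ℝ) := by
  unfold pushLaw; fun_prop

theorem continuous_pushEntropy {α β : Type*} [Fintype α] (f : α → β) :
    Continuous (pushEntropy f : (α → ℝ) → ℝ) :=
  continuous_finsetSum _ fun b _ =>
    continuous_negMulLog.comp ((continuous_apply b).comp (continuous_pushLaw f))

/-- Every probability vector is a limit of empirical laws of increasing length. -/
theorem exists_tendsto_empLaw {Ω : Type*} [Fintype Ω] {ν : Ω → ℝ} (hν : ν ∈ stdSimplex ℝ Ω) :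
    ∃ N : ℕ → ℕ, Tendsto N atTop atTop ∧ ∃ p : ∀ n, Fin (N n) → Ω,
      (∀ n, 0 < N n) ∧ Tendsto (fun n => empLaw (p n)) atTop (𝓝 ν) := by
  -- Rounding up makes the total length at least n + 1, hence positive and unbounded.
  set a : ℕ → Ω → ℕ := fun n ω => ⌈ν ω * (n + 1 : ℕ)⌉₊ with ha
  set N : ℕ → ℕ := fun n => ∑ ω, a n ω with hN
  have hlow : ∀ n, n + 1 ≤ N n := by
    intro n
    have : ((n + 1 : ℕ) : ℝ) ≤ N n := by
      calc ((n + 1 : ℕ) : ℝ) = ∑ ω, ν ω * (n + 1 : ℕ) := by rw [← sum_mul, hν.2, one_mul]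
        _ ≤ ∑ ω, (a n ω : ℝ) := sum_le_sum fun ω _ => Nat.le_ceil _
        _ = N n := by simp [hN]
    exact_mod_cast this
  have hcard : ∀ n, Fintype.card (Σ ω, Fin (a n ω)) = N n := by intro n; simp [hN]
  have hlim : ∀ ω, Tendsto (fun n : ℕ => (a n ω : ℝ) / (n + 1 : ℕ)) atTop (𝓝 (ν ω)) := fun ω =>
    (tendsto_nat_ceil_mul_div_atTop (hν.1 ω)).comp
      (tendsto_natCast_atTop_atTop.comp (tendsto_add_atTop_nat 1))
  have hlimN : Tendsto (fun n : ℕ => (N n : ℝ) / (n + 1 : ℕ)) atTop (𝓝 1) := by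
    rw [← hν.2]
    have := tendsto_finsetSum univ fun ω _ => hlim ω
    refine this.congr fun n => ?_
    rw [← sum_div, ← Nat.cast_sum]
  refine ⟨N, tendsto_atTop_mono (fun n => (Nat.le_succ n).trans (hlow n)) tendsto_id,
    fun n i => ((Fintype.equivFinOfCardEq (hcard n)).symm i).1,
    fun n => (Nat.succ_pos n).trans_le (hlow n), tendsto_pi_nhds.2 fun ω => ?_⟩
  have := (hlim ω).div hlimN one_ne_zero
  rw [div_one] at this
  refine this.congr fun n => ?_
  have hn : ((n + 1 : ℕ) : ℝ) ≠ 0 := by positivity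
  rw [Pi.div_apply, div_div_div_cancel_right₀ hn]
  simp only [empLaw, Fintype.card_fin]
  congr 2
  have hfib : #{s : Σ ω, Fin (a n ω) | s.1 = ω} = a n ω := by
    rw [← Fintype.card_subtype]
    exact (Fintype.card_congr (Equiv.sigmaSubtype ω)).trans (Fintype.card_fin _)
  rw [← hfib]
  exact card_bij (fun s _ => Fintype.equivFinOfCardEq (hcard n) s) (by simp) (by simp)
    (fun i hi => ⟨(Fintype.equivFinOfCardEq (hcard n)).symm i, by simpa using hi, by simp⟩)

/-- The entropic sum triangle inequality on a finite probability space. -/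
theorem pushEntropy_triangle {Ω T : Type*} [Fintype Ω] [AddCommGroup T] {ν : Ω → ℝ}
    (hν : ν ∈ stdSimplex ℝ Ω) (X Y Z : Ω → T) :
    ∃ c ∈ stdSimplex ℝ (Ω × Ω), ∃ d ∈ stdSimplex ℝ (Ω × Ω),
      pushLaw Prod.fst c = ν ∧ pushLaw Prod.snd c = ν ∧
      pushLaw Prod.fst d = ν ∧ pushLaw Prod.snd d = ν ∧
      pushEntropy X ν + pushEntropy (fun ω => Y ω + Z ω) ν ≤
        pushEntropy (fun z : Ω × Ω => X z.1 + Y z.2) c +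
        pushEntropy (fun z : Ω × Ω => X z.1 + Z z.2) d := by
  obtain ⟨N, hN, p, hpos, hp⟩ := exists_tendsto_empLaw hν
  have key : ∀ n, _ := fun n =>
    haveI : Nonempty (Fin (N n)) := ⟨⟨0, hpos n⟩⟩
    empLaw_entropy_triangle (p n) X Y Z
  choose c hc d hd hc1 hc2 hd1 hd2 hle using key
  obtain ⟨⟨c₀, d₀⟩, hcd, φ, hφ, hlim⟩ :=
    ((isCompact_stdSimplex ℝ (Ω × Ω)).prod (isCompact_stdSimplex ℝ (Ω × Ω))).tendsto_subseq
      (x := fun n => (c n, d n)) fun n => ⟨hc n, hd n⟩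
  have hclim : Tendsto (fun n => c (φ n)) atTop (𝓝 c₀) := (continuous_fst.tendsto _).comp hlim
  have hdlim : Tendsto (fun n => d (φ n)) atTop (𝓝 d₀) := (continuous_snd.tendsto _).comp hlim
  have hplim := hp.comp hφ.tendsto_atTop
  have hmarg : ∀ (f : Ω × Ω → Ω) (e : ℕ → Ω × Ω → ℝ) (e₀ : Ω × Ω → ℝ),
      Tendsto (fun n => e (φ n)) atTop (𝓝 e₀) → (∀ n, pushLaw f (e n) = empLaw (p n)) →
      pushLaw f e₀ = ν := fun f e e₀ he h =>
    tendsto_nhds_unique (((continuous_pushLaw f).tendsto _).comp he)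
      (hplim.congr fun n => (h (φ n)).symm)
  refine ⟨c₀, hcd.1, d₀, hcd.2, hmarg _ _ _ hclim hc1, hmarg _ _ _ hclim hc2,
    hmarg _ _ _ hdlim hd1, hmarg _ _ _ hdlim hd2, ?_⟩
  have herr : Tendsto (fun x : ℝ => log (x + 1) / x) atTop (𝓝 0) := by
    have h1 := isLittleO_log_id_atTop.tendsto_div_nhds_zero.comp
      (tendsto_atTop_add_const_right _ (1 : ℝ) tendsto_id)
    have h2 : Tendsto (fun x : ℝ => 1 + x⁻¹) atTop (𝓝 (1 + 0)) :=
      tendsto_const_nhds.add tendsto_inv_atTop_zero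
    have h3 := h1.mul h2
    rw [zero_mul] at h3
    refine h3.congr' ?_
    filter_upwards [eventually_gt_atTop 0] with x hx
    simp only [Function.comp, id]
    field_simp
  have herr' : Tendsto (fun n => 4 * (Fintype.card Ω : ℝ) *
      (log (Fintype.card (Fin (N (φ n))) + 1) / Fintype.card (Fin (N (φ n))))) atTop (𝓝 0) := by
    simp only [Fintype.card_fin]
    have := (herr.comp (tendsto_natCast_atTop_atTop.comp (hN.comp hφ.tendsto_atTop))).const_mul
      (4 * (Fintype.card Ω : ℝ))
    rwa [mul_zero] at this
  have hL := (((continuous_pushEntropy X).tendsto ν).comp hplim).add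
    (((continuous_pushEntropy fun ω => Y ω + Z ω).tendsto ν).comp hplim)
  have hR := ((((continuous_pushEntropy fun z : Ω × Ω => X z.1 + Y z.2).tendsto c₀).comp
    hclim).add (((continuous_pushEntropy fun z : Ω × Ω => X z.1 + Z z.2).tendsto d₀).comp
    hdlim)).add herr'
  rw [add_zero] at hR
  exact le_of_tendsto_of_tendsto' hL hR fun n => hle (φ n)

end EmpiricalInequality

/-! ### Couplings of finitely supported laws -/

section Couplings

open scoped Classical
open Finset Real

/-- The probabilities of a discrete distribution as real numbers. -/
noncomputable def pmfReal {α : Type*} (p : PMF α) (a : α) : ℝ := (p a).toReal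

theorem pmfReal_injective {α : Type*} : Function.Injective (pmfReal : PMF α → α → ℝ) := by
  intro p q h
  ext a
  exact (ENNReal.toReal_eq_toReal_iff' (p.apply_ne_top a) (q.apply_ne_top a)).1 (congrFun h a)

theorem pmfReal_mem_stdSimplex {α : Type*} [Fintype α] (p : PMF α) :
    pmfReal p ∈ stdSimplex ℝ α := by
  refine ⟨fun a => ENNReal.toReal_nonneg, ?_⟩
  simp only [pmfReal]
  rw [← ENNReal.toReal_sum fun a _ => p.apply_ne_top a, ← tsum_fintype (L := .unconditional _), p.tsum_coe,
    ENNReal.toReal_one]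

theorem exists_pmfReal_eq {α : Type*} [Fintype α] {c : α → ℝ} (hc : c ∈ stdSimplex ℝ α) :
    ∃ p : PMF α, pmfReal p = c := by
  refine ⟨PMF.ofFintype (fun a => ENNReal.ofReal (c a)) ?_, ?_⟩
  · rw [← ENNReal.ofReal_sum_of_nonneg fun a _ => hc.1 a, hc.2, ENNReal.ofReal_one]
  · funext a
    simp [pmfReal, ENNReal.toReal_ofReal (hc.1 a)]

theorem pmfReal_map {α β : Type*} [Fintype α] (f : α → β) (p : PMF α) :
    pmfReal (p.map f) = pushLaw f (pmfReal p) := by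
  funext b
  simp only [pmfReal, pushLaw]
  rw [PMF.map_apply, tsum_fintype, ← ENNReal.toReal_sum fun a _ => p.apply_ne_top a, sum_filter]
  simp only [eq_comm]

theorem shannonEntropy_map {α β : Type*} [Fintype α] (f : α → β) (p : PMF α) :
    shannonEntropy (p.map f) = pushEntropy f (pmfReal p) := by
  have h : ∀ b, ((p.map f) b).toReal = pushLaw f (pmfReal p) b := fun b =>
    congrFun (pmfReal_map f p) b
  simp only [shannonEntropy, h]
  refine tsum_eq_sum fun b hb => ?_
  have : pushLaw f (pmfReal p) b = 0 := by
    refine sum_eq_zero fun a ha => absurd ?_ hb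
    exact mem_image.2 ⟨a, mem_univ _, (mem_filter.1 ha).2⟩
  rw [this, negMulLog_zero]

theorem exists_map_subtype_val_eq {α : Type*} (p : PMF α) {s : Set α} (hs : p.support ⊆ s) :
    ∃ p' : PMF s, p'.map Subtype.val = p := by
  have hsupp : Function.support (p : α → ENNReal) ⊆ s := hs
  have hsum : HasSum (fun a : s => p a) 1 := by
    rw [Summable.hasSum_iff ENNReal.summable, tsum_subtype_eq_of_support_subset hsupp, p.tsum_coe]
  set p' : PMF s := ⟨fun a => p a, hsum⟩
  refine ⟨p', ?_⟩
  ext b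
  have hp' : ∀ a : s, p' a = p a := fun _ => rfl
  rw [PMF.map_apply]
  simp only [hp']
  rw [tsum_subtype_eq_of_support_subset (f := fun a => if b = a then p a else 0)]
  · simp
  · exact fun a ha => hs fun h => ha (by simp [h])

theorem couplings_nonempty {α β : Type*} (P : PMF α) (Q : PMF β) : (couplings P Q).Nonempty := by
  refine ⟨P.bind fun a => Q.map fun b => (a, b), ?_, ?_⟩
  · simp only [PMF.map_bind, PMF.map_comp, Function.comp_def]
    exact (congrArg P.bind (funext fun a => PMF.map_const Q a)).trans P.bind_pure
  · simp only [PMF.map_bind, PMF.map_comp, Function.comp_def]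
    exact (PMF.bind_const P _).trans (PMF.map_id Q)

theorem support_subset_prod_of_mem_couplings {α β : Type*} {P : PMF α} {Q : PMF β}
    {μ : PMF (α × β)} (hμ : μ ∈ couplings P Q) : μ.support ⊆ P.support ×ˢ Q.support := by
  intro z hz
  refine ⟨?_, ?_⟩
  · rw [← hμ.1, PMF.support_map]; exact ⟨z, hz, rfl⟩
  · rw [← hμ.2, PMF.support_map]; exact ⟨z, hz, rfl⟩

/-- Couplings live on the finite product of the supports, where they form a closed part of a simplex
on which entropy is continuous. -/
theorem isCompact_couplingSumEntropies {T : Type*} [AddCommGroup T] {P Q : PMF T}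
    (hP : P.support.Finite) (hQ : Q.support.Finite) : IsCompact (couplingSumEntropies P Q) := by
  set s : Set (T × T) := P.support ×ˢ Q.support with hs
  have : Fintype s := (hP.prod hQ).fintype
  set K : Set (s → ℝ) := stdSimplex ℝ s ∩
    {c | pushLaw (Prod.fst ∘ Subtype.val) c = pmfReal P ∧
      pushLaw (Prod.snd ∘ Subtype.val) c = pmfReal Q} with hK
  have hKc : IsCompact K := (isCompact_stdSimplex ℝ s).inter_right
    ((isClosed_eq (continuous_pushLaw _) continuous_const).inter
      (isClosed_eq (continuous_pushLaw _) continuous_const))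
  have hcoup : ∀ m : PMF s, m.map Subtype.val ∈ couplings P Q ↔ pmfReal m ∈ K := by
    intro m
    simp only [couplings, Set.mem_ofPred_eq, PMF.map_comp, hK, Set.mem_inter_iff,
      pmfReal_mem_stdSimplex, true_and, ← pmfReal_map, pmfReal_injective.eq_iff]
  have himg : couplingSumEntropies P Q =
      pushEntropy ((fun z : T × T => z.1 + z.2) ∘ (Subtype.val : s → T × T)) '' K := by
    ext h
    constructor
    · rintro ⟨μ, hμ, rfl⟩
      obtain ⟨m, rfl⟩ := exists_map_subtype_val_eq μ (support_subset_prod_of_mem_couplings hμ)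
      refine ⟨pmfReal m, (hcoup m).1 hμ, ?_⟩
      simp only [← shannonEntropy_map, PMF.map_comp]
      rfl
    · rintro ⟨c, hc, rfl⟩
      obtain ⟨m, rfl⟩ := exists_pmfReal_eq hc.1
      refine ⟨m.map Subtype.val, (hcoup m).2 hc, ?_⟩
      simp only [PMF.map_comp, shannonEntropy_map]
  rw [himg]
  exact hKc.image (continuous_pushEntropy _)

theorem isGreatest_maxSumEntropy {T : Type*} [AddCommGroup T] {P Q : PMF T}
    (hP : P.support.Finite) (hQ : Q.support.Finite) :
    IsGreatest (couplingSumEntropies P Q) (maxSumEntropy P Q) :=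
  (isCompact_couplingSumEntropies hP hQ).isGreatest_sSup ((couplings_nonempty P Q).image _)

theorem pushEntropy_le_maxSumEntropy {Ω T : Type*} [Fintype Ω] [AddCommGroup T] (ν : PMF Ω)
    (X Y : Ω → T) {c : Ω × Ω → ℝ} (hc : c ∈ stdSimplex ℝ (Ω × Ω))
    (h1 : pushLaw Prod.fst c = pmfReal ν) (h2 : pushLaw Prod.snd c = pmfReal ν)
    (hX : (ν.map X).support.Finite) (hY : (ν.map Y).support.Finite) :
    pushEntropy (fun z : Ω × Ω => X z.1 + Y z.2) c ≤ maxSumEntropy (ν.map X) (ν.map Y) := by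
  obtain ⟨m, rfl⟩ := exists_pmfReal_eq hc
  rw [← pmfReal_map, pmfReal_injective.eq_iff] at h1 h2
  refine (isGreatest_maxSumEntropy hX hY).2 ⟨m.map (Prod.map X Y), ⟨?_, ?_⟩, ?_⟩
  · rw [← h1, PMF.map_comp, PMF.map_comp]; rfl
  · rw [← h2, PMF.map_comp, PMF.map_comp]; rfl
  · simp only [PMF.map_comp, ← shannonEntropy_map]; rfl

/-- The entropic sum triangle inequality for maximal couplings. -/
theorem maxSumEntropy_triangle {T : Type*} [AddCommGroup T] {PX PY PZ : PMF T}
    (hX : PX.support.Finite) (hY : PY.support.Finite) (hZ : PZ.support.Finite) :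
    shannonEntropy PX + maxSumEntropy PY PZ ≤ maxSumEntropy PX PY + maxSumEntropy PX PZ := by
  obtain ⟨μ, hμ, hμmax⟩ := (isGreatest_maxSumEntropy hY hZ).1
  have : Fintype PX.support := hX.fintype
  have : Fintype μ.support :=
    ((hY.prod hZ).subset (support_subset_prod_of_mem_couplings hμ)).fintype
  obtain ⟨p, hp⟩ := exists_map_subtype_val_eq PX subset_rfl
  obtain ⟨m, hm⟩ := exists_map_subtype_val_eq μ subset_rfl
  -- Any coupling of X with the optimal pair will do: only these two marginals enter.
  obtain ⟨ν, hν1, hν2⟩ := couplings_nonempty p m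
  set X : PX.support × μ.support → T := fun ω => ω.1.1
  set Y : PX.support × μ.support → T := fun ω => ω.2.1.1
  set Z : PX.support × μ.support → T := fun ω => ω.2.1.2
  have hνX : ν.map X = PX := by
    have h : (ν.map Prod.fst).map Subtype.val = PX := by rw [hν1, hp]
    rwa [PMF.map_comp] at h
  have hνμ : (ν.map Prod.snd).map Subtype.val = μ := by rw [hν2, hm]
  rw [PMF.map_comp] at hνμ
  have hνf : ∀ f : T × T → T, ν.map (f ∘ Subtype.val ∘ Prod.snd) = μ.map f := fun f => by
    rw [← PMF.map_comp]
    exact congrArg (PMF.map f) hνμ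
  have hνY : ν.map Y = PY := (hνf Prod.fst).trans hμ.1
  have hνZ : ν.map Z = PZ := (hνf Prod.snd).trans hμ.2
  have hνYZ : ν.map (fun ω => Y ω + Z ω) = μ.map fun z => z.1 + z.2 := hνf fun z => z.1 + z.2
  obtain ⟨c, hc, d, hd, hc1, hc2, hd1, hd2, hle⟩ :=
    pushEntropy_triangle (pmfReal_mem_stdSimplex ν) X Y Z
  rw [← shannonEntropy_map, ← shannonEntropy_map, hνX, hνYZ] at hle
  have h1 := pushEntropy_le_maxSumEntropy ν X Y hc hc1 hc2 (by rwa [hνX]) (by rwa [hνY])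
  have h2 := pushEntropy_le_maxSumEntropy ν X Z hd hd1 hd2 (by rwa [hνX]) (by rwa [hνZ])
  rw [hνX, hνY] at h1
  rw [hνX, hνZ] at h2
  simp only at hμmax
  linarith

end Couplings

theorem mainTheorem7 {T : Type*} [AddCommGroup T] [AddGroup.FG T] [IsAddTorsionFree T]
    [DecidableEq T] :
    -- the supremum defining `maxSumEntropy` is an attained maximum
    (∀ P Q : PMF T, P.support.Finite → Q.support.Finite →
      IsGreatest (couplingSumEntropies P Q) (maxSumEntropy P Q)) ∧
    -- the entropic inequality
    (∀ PX PY PZ : PMF T, PX.support.Finite → PY.support.Finite → PZ.support.Finite →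
      shannonEntropy PX + maxSumEntropy PY PZ ≤ maxSumEntropy PX PY + maxSumEntropy PX PZ) ∧
    -- its equivalence with the sumset inequality
    ((∀ A B C : Finset T, A.card * (B + C).card ≤ (A + B).card * (A + C).card) ↔
      (∀ PX PY PZ : PMF T, PX.support.Finite → PY.support.Finite → PZ.support.Finite →
        shannonEntropy PX + maxSumEntropy PY PZ ≤
          maxSumEntropy PX PY + maxSumEntropy PX PZ)) := by
  refine ⟨fun P Q hP hQ => isGreatest_maxSumEntropy hP hQ,
    fun PX PY PZ hX hY hZ => maxSumEntropy_triangle hX hY hZ,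
    fun _ PX PY PZ hX hY hZ => maxSumEntropy_triangle hX hY hZ, fun _ A B C => ?_⟩
  rw [mul_comm A.card, add_comm A B]
  exact Finset.ruzsa_triangle_inequality_add_add_add B A C
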